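/- All graphs are finite and simple; the empty graph is allowed. A graph is 2-connected if it has at least two vertices, is connected, and remains connected after the removal of any single vertex (so $K_2$ is 2-connected). For graphs $H$ and $G$ let $H(G)$ be the number of (not necessarily induced) subgraphs of $G$ isomorphic to $H$; for a class $\mathcal H$ of graphs let $\mathbb C\mathcal H$ be the complex vector space of all finite linear combinations of the functions $G\mapsto H(G)$ with $H\in\mathcal H$. Let $f$ assign to every graph $G$ a polynomial $f(G,x)\in\mathbb C[x]$ such that: 1. (isomorphism-invariant) $f(G_1,x)=f(G_2,x)$ whenever $G_1\simeq G_2$; 2. (monic) $f(G,x)$ is monic of degree $|V(G)|$ for every $G$; 3. (exponential type) $f(\emptyset,x)=1$ and $\sum_{S\subseteq V(G)} f(G[S],x)\,f(G[V(G)\setminus S],y)=f(G,x+y)$ for every $G$; 4. (2-multiplicative) $f(G_1\cup G_2,x)=f(G_1,x)f(G_2,x)$ whenever $G_1$ and $G_2$ have no vertex in common, and $x\,f(G_1\cup G_2,x)=f(G_1,x)f(G_2,x)$ whenever $G_1$ and $G_2$ have exactly one vertex in common. For $k\ge 1$ let $p_k(G)$ be the $k$-th power sum of the roots of $f(G,x)$,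 counted with multiplicity. Then for every $k\ge1$ $$p_k\in\mathbb C\{H : H \text{ is 2-connected and } 2\le |V(H)|\le k+1\}.$$ -/

import Mathlib

universe u

/-- A finite simple graph, bundled with its vertex set. The empty graph is allowed. -/
structure FinGraph where
  /-- The vertex set. -/
  V : Type u
  [fintypeV : Fintype V]
  /-- The adjacency structure. -/
  graph : SimpleGraph V

attribute [instance] FinGraph.fintypeV

namespace FinGraph

/-- The subgraph `G[S]` induced by a set `S` of vertices. -/
noncomputable def induce (G : FinGraph.{u}) (S : Set G.V) : FinGraph.{u} :=
  letI : Fintype S := Fintype.ofFinite S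
  ⟨S, G.graph.induce S⟩

/-- A (not necessarily induced) subgraph of `G`, seen as a graph in its own right. -/
noncomputable def ofSubgraph (G : FinGraph.{u}) (A : G.graph.Subgraph) : FinGraph.{u} :=
  letI : Fintype A.verts := Fintype.ofFinite A.verts
  ⟨A.verts, A.coe⟩

/-- `2`-connected: at least two vertices, connected, and still connected after the removal of any
one vertex. In particular the complete graph on two vertices is `2`-connected. -/
def IsTwoConnected (G : FinGraph.{u}) : Prop :=
  2 ≤ Fintype.card G.V ∧ G.graph.Connected ∧ ∀ v : G.V, (G.induce {v}ᶜ).graph.Connected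

/-- The function `G ↦ H(G)`, where `H(G)` is the number of subgraphs of `G` (not necessarily
induced) that are isomorphic to `H`. -/
noncomputable def subgraphCount (H : FinGraph.{u}) : FinGraph.{u} → ℂ :=
  fun G => (G.graph.copyCount H.graph : ℂ)

/-- The vector space `ℂ 𝓗` of finite linear combinations of the functions `G ↦ H(G)`, `H ∈ 𝓗`. -/
noncomputable def countSpan (𝓗 : Set FinGraph.{u}) : Submodule ℂ (FinGraph.{u} → ℂ) :=
  Submodule.span ℂ (subgraphCount '' 𝓗)

end FinGraph

/-- A graph polynomial assigns a complex polynomial to every finite simple graph. -/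
abbrev GraphPolynomial := FinGraph.{u} → Polynomial ℂ

namespace GraphPolynomial

/-- Isomorphic graphs have the same polynomial. -/
def IsomInvariant (f : GraphPolynomial.{u}) : Prop :=
  ∀ G₁ G₂ : FinGraph.{u}, Nonempty (G₁.graph ≃g G₂.graph) → f G₁ = f G₂

/-- `f(G, x)` is monic of degree `|V(G)|` for every graph `G`. -/
def IsMonic (f : GraphPolynomial.{u}) : Prop :=
  ∀ G : FinGraph.{u}, (f G).Monic ∧ (f G).natDegree = Fintype.card G.V

/-- Exponential type: `f(∅, x) = 1` and `∑_{S ⊆ V(G)} f(G[S], x) f(G - S, y) = f(G, x + y)`. -/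
def IsExponentialType (f : GraphPolynomial.{u}) : Prop :=
  (∀ G : FinGraph.{u}, IsEmpty G.V → f G = 1) ∧
    ∀ (G : FinGraph.{u}) (x y : ℂ),
      ∑ S : Finset G.V, (f (G.induce (S : Set G.V))).eval x *
        (f (G.induce (S : Set G.V)ᶜ)).eval y = (f G).eval (x + y)

/-- `f(G, x) = f(G₁, x) f(G₂, x)` whenever `G` is the union of its vertex-disjoint subgraphs
`G₁` and `G₂`. -/
def IsMultiplicative (f : GraphPolynomial.{u}) : Prop :=
  ∀ (G : FinGraph.{u}) (G₁ G₂ : G.graph.Subgraph), G₁ ⊔ G₂ = ⊤ → Disjoint G₁.verts G₂.verts →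
    f G = f (G.ofSubgraph G₁) * f (G.ofSubgraph G₂)

/-- `2`-multiplicative: multiplicative, and `x f(G, x) = f(G₁, x) f(G₂, x)` whenever `G` is the
union of its subgraphs `G₁` and `G₂`, which have exactly one vertex in common. -/
def IsTwoMultiplicative (f : GraphPolynomial.{u}) : Prop :=
  f.IsMultiplicative ∧
    ∀ (G : FinGraph.{u}) (G₁ G₂ : G.graph.Subgraph), G₁ ⊔ G₂ = ⊤ →
      (∃ v : G.V, G₁.verts ∩ G₂.verts = {v}) →
        Polynomial.X * f G = f (G.ofSubgraph G₁) * f (G.ofSubgraph G₂)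

/-- The `k`-th power sum `p_k(G)` of the roots of `f(G, x)`, counted with multiplicity. -/
noncomputable def powerSum (f : GraphPolynomial.{u}) (k : ℕ) : FinGraph.{u} → ℂ :=
  fun G => ((f G).roots.map (fun z => z ^ k)).sum

end GraphPolynomial

/-! Fix `G` and view a graph invariant as a function on the poset of subgraphs of `G`. By Möbius
inversion `p_k(G)` is a sum over subgraphs of weights that depend only on the isomorphism type
(`mobius_map`), so it suffices that nonzero weights occur only at 2-connected graphs with at most `k
+ 1` vertices (`mem_countSpan`).

Connectivity: for `k ≥ 1` the power sums are additive over unions overlapping in at most one vertex,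
because the root 0 of `X` contributes nothing, and they vanish on single vertices.
Inclusion-exclusion then kills the weight of every properly decomposable subgraph
(`mobius_eq_zero_of_additive`).

Order: filter the functions of `A` by the graphic rank of the `D` in the indicators `D ≤ A` that
span them. Indicators multiply by taking unions and rank is subadditive, so the filtration is
multiplicative. Exponential type gives `F(A)' = ∑_S [x]F(A[S]) · F(A - S)`, a recursion for the
coefficient `c_k` of codegree `k`. Moving its singleton terms `c_k(A - v)` to the left leaves an
operator that multiplies the Möbius inverse at `D` by `|D| - k`, nonzero once `rank D > k`; the
remaining terms have rank at most `k` by induction (`codegCoeff_mem_rankSpan`). Newton's identities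
carry the bound over to `p_k`, and a connected subgraph on `n` vertices has rank at least `n - 1`.
-/

/-! ### Möbius inversion on finite posets -/

namespace FinPoset

open scoped Classical in
/-- Summation of a function over lower sets, as a linear map. -/
noncomputable def lowerSum (α : Type*) [PartialOrder α] [Fintype α] :
    (α → ℂ) →ₗ[ℂ] (α → ℂ) where
  toFun m a := ∑ b with b ≤ a, m b
  map_add' m m' := by ext a; simp [Finset.sum_add_distrib]
  map_smul' c m := by ext a; simp [Finset.mul_sum]

section

variable {α : Type*} [PartialOrder α] [Fintype α]

open scoped Classical in
theorem lowerSum_apply (m : α → ℂ) (a : α) : lowerSum α m a = ∑ b with b ≤ a, m b := rfl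

open scoped Classical in
theorem lowerSum_eq_add (m : α → ℂ) (a : α) :
    lowerSum α m a = m a + ∑ b with b < a, m b := by
  rw [lowerSum_apply]
  have : (Finset.univ.filter (· ≤ a) : Finset α) = insert a (Finset.univ.filter (· < a)) := by
    ext b; simp [le_iff_eq_or_lt]
  rw [this, Finset.sum_insert (by simp)]

theorem lowerSum_injective : Function.Injective (lowerSum α) := by
  classical
  rw [← LinearMap.ker_eq_bot, LinearMap.ker_eq_bot']
  intro m hm
  ext a
  induction a using WellFoundedLT.induction with
  | ind a ih =>
    have h := congrFun hm a
    rw [lowerSum_eq_add, Finset.sum_eq_zero] at h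
    · simpa using h
    · intro b hb
      exact ih b (by simpa using hb)

/-- The Möbius inverse of a function on a finite poset. -/
noncomputable def mobius (φ : α → ℂ) : α → ℂ :=
  (LinearEquiv.ofInjectiveEndo (lowerSum α) lowerSum_injective).symm φ

@[simp]
theorem lowerSum_mobius (φ : α → ℂ) : lowerSum α (mobius φ) = φ :=
  (LinearEquiv.ofInjectiveEndo (lowerSum α) lowerSum_injective).apply_symm_apply φ

theorem eq_mobius {m φ : α → ℂ} (h : lowerSum α m = φ) : m = mobius φ :=
  lowerSum_injective (by rw [h, lowerSum_mobius])

/-- If `φ` vanishes on everything below `a`, so does its Möbius inverse. -/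
theorem mobius_eq_zero_of_forall_le {φ : α → ℂ} {a : α} (h : ∀ b ≤ a, φ b = 0) :
    mobius φ a = 0 := by
  classical
  induction a using WellFoundedLT.induction with
  | ind a ih =>
    have h' := congrFun (lowerSum_mobius φ) a
    rw [lowerSum_eq_add, h a le_rfl, Finset.sum_eq_zero] at h'
    · simpa using h'
    · intro b hb
      have hb' : b < a := by simpa using hb
      exact ih b hb' fun c hc => h c (hc.trans hb'.le)

end

section Lattice

variable {α : Type*} [DistribLattice α] [Fintype α]

/-- A function additive on the decompositions `a = a₁ ⊔ a₂` admitted by a hereditary predicate has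
vanishing Möbius inverse at the properly decomposable elements. -/
theorem mobius_eq_zero_of_additive {φ : α → ℂ} {P : α → α → Prop}
    (hP : ∀ a b c, P a b → P (c ⊓ a) (c ⊓ b))
    (hadd : ∀ a b, P a b → φ (a ⊔ b) = φ a + φ b) (hinf : ∀ a b, P a b → φ (a ⊓ b) = 0)
    {a a₁ a₂ : α} (h : P a₁ a₂) (ha : a₁ ⊔ a₂ = a) (h₁ : a₁ ≠ a) (h₂ : a₂ ≠ a) :
    mobius φ a = 0 := by
  classical
  induction a using WellFoundedLT.induction generalizing a₁ a₂ with
  | ind a ih =>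
    subst ha
    -- Inclusion-exclusion. An element `b` below the join but below neither part equals `(b ⊓ a₁) ⊔
    -- (b ⊓ a₂)`, so it is itself properly decomposable; by induction only the top survives.
    have key : ∀ b : α, (if b ≤ a₁ ⊔ a₂ then mobius φ b else 0) =
        (if b ≤ a₁ then mobius φ b else 0) + (if b ≤ a₂ then mobius φ b else 0)
          - (if b ≤ a₁ ⊓ a₂ then mobius φ b else 0)
          + (if b = a₁ ⊔ a₂ then mobius φ b else 0) := by
      intro b
      by_cases hb : b = a₁ ⊔ a₂
      · have hb₁ : ¬ b ≤ a₁ := fun hle =>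
          h₁ (le_antisymm le_sup_left (hb ▸ hle))
        have hb₂ : ¬ b ≤ a₂ := fun hle =>
          h₂ (le_antisymm le_sup_right (hb ▸ hle))
        have hb₃ : ¬ b ≤ a₁ ⊓ a₂ := fun hle => hb₁ (hle.trans inf_le_left)
        have hb₄ : b ≤ a₁ ⊔ a₂ := hb.le
        rw [if_pos hb₄, if_neg hb₁, if_neg hb₂, if_neg hb₃, if_pos hb]
        simp
      · rw [if_neg hb]
        by_cases hb₁ : b ≤ a₁ <;> by_cases hb₂ : b ≤ a₂
        · simp [hb₁, hb₂, hb₁.trans le_sup_left]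
        · simp [hb₁, hb₂, hb₁.trans le_sup_left]
        · simp [hb₁, hb₂, hb₂.trans le_sup_right]
        · by_cases hb₃ : b ≤ a₁ ⊔ a₂
          · have := ih b (lt_of_le_of_ne hb₃ hb) (hP _ _ b h)
              (by rw [← inf_sup_left, inf_eq_left.mpr hb₃])
              (fun h => hb₁ (inf_eq_left.mp h)) (fun h => hb₂ (inf_eq_left.mp h))
            simp [this]
          · simp [hb₁, hb₂, hb₃]
    have hsum := Finset.sum_congr rfl (s₁ := (Finset.univ : Finset α)) fun b _ => key b
    rw [Finset.sum_add_distrib, Finset.sum_sub_distrib, Finset.sum_add_distrib] at hsum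
    simp only [← Finset.sum_filter, ← lowerSum_apply, lowerSum_mobius, hadd _ _ h, hinf _ _ h] at hsum
    simpa [Finset.sum_filter] using hsum

end Lattice

/-! ### The filtration of functions by rank -/

section Rank

variable {α : Type*} [SemilatticeSup α]

open scoped Classical in
/-- The indicator function of the elements above `d`. -/
noncomputable def upIndicator (d : α) : α → ℂ := fun a => if d ≤ a then 1 else 0

/-- The span of the indicator functions of the principal upper sets of elements of rank at most
`k`. -/
noncomputable def rankSpan (r : α → ℕ) (k : ℕ) : Submodule ℂ (α → ℂ) :=
  Submodule.span ℂ (upIndicator '' {d | r d ≤ k})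

theorem upIndicator_mem_rankSpan {r : α → ℕ} {k : ℕ} {d : α} (h : r d ≤ k) :
    upIndicator d ∈ rankSpan r k :=
  Submodule.subset_span ⟨d, h, rfl⟩

theorem upIndicator_mul (d e : α) : upIndicator d * upIndicator e = upIndicator (d ⊔ e) := by
  ext a
  by_cases h : d ≤ a <;> by_cases h' : e ≤ a <;> simp [upIndicator, h, h']

theorem mul_mem_rankSpan {r : α → ℕ} (hr : ∀ a b, r (a ⊔ b) ≤ r a + r b) {j k : ℕ}
    {φ ψ : α → ℂ} (hφ : φ ∈ rankSpan r j) (hψ : ψ ∈ rankSpan r k) :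
    φ * ψ ∈ rankSpan r (j + k) := by
  have h : rankSpan r j * rankSpan r k ≤ rankSpan r (j + k) := by
    rw [rankSpan, rankSpan, Submodule.span_mul_span, Submodule.span_le]
    rintro _ ⟨_, ⟨d, hd, rfl⟩, _, ⟨e, he, rfl⟩, rfl⟩
    simp only [upIndicator_mul]
    exact upIndicator_mem_rankSpan ((hr d e).trans (add_le_add hd he))
  exact h (Submodule.mul_mem_mul hφ hψ)

/-- Reduces, by linearity, statements about deleting or inducing on a vertex set to single
indicators. -/
theorem mul_comp_mem_of_rankSpan {r : α → ℕ} {k : ℕ} {P : Submodule ℂ (α → ℂ)} {w : α → ℂ}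
    {g : α → α} (h : ∀ d, r d ≤ k → (fun a => w a * upIndicator d (g a)) ∈ P) {φ : α → ℂ}
    (hφ : φ ∈ rankSpan r k) : (fun a => w a * φ (g a)) ∈ P := by
  refine Submodule.span_induction (p := fun φ _ => (fun a => w a * φ (g a)) ∈ P) ?_ ?_ ?_ ?_ hφ
  · rintro _ ⟨d, hd, rfl⟩
    exact h d hd
  · convert P.zero_mem using 1
    ext; simp
  · intro x y _ _ hx hy
    convert P.add_mem hx hy using 1
    ext; simp [mul_add]
  · intro c x _ hx
    convert P.smul_mem c hx using 1
    ext; simp [mul_left_comm]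

variable [Fintype α]

/-- The Möbius inverse of `upIndicator d` is the point mass at `d`. -/
theorem mobius_eq_zero_of_mem_rankSpan {r : α → ℕ} {k : ℕ} {φ : α → ℂ} (hφ : φ ∈ rankSpan r k)
    {d : α} (hd : k < r d) : mobius φ d = 0 := by
  classical
  suffices h : ∃ m, lowerSum α m = φ ∧ ∀ d, k < r d → m d = 0 by
    obtain ⟨m, hm, h⟩ := h
    rw [← eq_mobius hm]
    exact h d hd
  refine Submodule.span_induction
    (p := fun φ _ => ∃ m, lowerSum α m = φ ∧ ∀ d, k < r d → m d = 0) ?_ ?_ ?_ ?_ hφ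
  · rintro _ ⟨d, hd, rfl⟩
    refine ⟨Pi.single d 1, ?_, ?_⟩
    · ext a
      simp [lowerSum_apply, upIndicator, Pi.single_apply, Finset.sum_ite_eq']
    · intro e he
      refine Pi.single_eq_of_ne ?_ _
      rintro rfl
      exact absurd hd (by simpa using he)
  · exact ⟨0, by simp, by simp⟩
  · rintro x y _ _ ⟨m, hm, h⟩ ⟨m', hm', h'⟩
    exact ⟨m + m', by simp [hm, hm'], fun d hd => by simp [h d hd, h' d hd]⟩
  · rintro c x _ ⟨m, hm, h⟩
    exact ⟨c • m, by simp [hm], fun d hd => by simp [h d hd]⟩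

theorem lowerSum_eq_sum_smul (m : α → ℂ) : lowerSum α m = ∑ d, m d • upIndicator d := by
  classical
  ext a
  simp [lowerSum_apply, upIndicator, Finset.sum_filter]

theorem mem_rankSpan_of_mobius_eq_zero {r : α → ℕ} {k : ℕ} {φ : α → ℂ}
    (h : ∀ d, k < r d → mobius φ d = 0) : φ ∈ rankSpan r k := by
  rw [← lowerSum_mobius φ, lowerSum_eq_sum_smul]
  refine Submodule.sum_mem _ fun d _ => ?_
  rcases le_or_gt (r d) k with hd | hd
  · exact Submodule.smul_mem _ _ (upIndicator_mem_rankSpan hd)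
  · rw [h d hd, zero_smul]
    exact Submodule.zero_mem _

end Rank

end FinPoset

/-! ### The rank of a subgraph -/

namespace SimpleGraph.Subgraph

variable {V : Type u} {G : SimpleGraph V}

open scoped Classical in
/-- The span of the vectors `e_u - e_v` over the edges `uv` of a subgraph. -/
noncomputable def edgeSpan (A : G.Subgraph) : Submodule ℚ (V → ℚ) :=
  Submodule.span ℚ {x | ∃ u v, A.Adj u v ∧ x = Pi.single u 1 - Pi.single v 1}

/-- The rank of a subgraph in the graphic matroid. -/
noncomputable def rank (A : G.Subgraph) : ℕ := Module.finrank ℚ A.edgeSpan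

theorem edgeSpan_sup (A B : G.Subgraph) : (A ⊔ B).edgeSpan = A.edgeSpan ⊔ B.edgeSpan := by
  classical
  rw [edgeSpan, edgeSpan, edgeSpan, ← Submodule.span_union]
  congr 1
  ext x
  constructor
  · rintro ⟨u, v, h | h, rfl⟩
    · exact Or.inl ⟨u, v, h, rfl⟩
    · exact Or.inr ⟨u, v, h, rfl⟩
  · rintro (⟨u, v, h, rfl⟩ | ⟨u, v, h, rfl⟩)
    · exact ⟨u, v, Or.inl h, rfl⟩
    · exact ⟨u, v, Or.inr h, rfl⟩

theorem rank_sup_le [Fintype V] (A B : G.Subgraph) : (A ⊔ B).rank ≤ A.rank + B.rank := by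
  rw [rank, edgeSpan_sup]
  exact Submodule.finrank_add_le_finrank_add_finrank _ _

theorem rank_eq_zero_of_forall_not_adj {A : G.Subgraph} (h : ∀ u v, ¬ A.Adj u v) : A.rank = 0 := by
  have : A.edgeSpan = ⊥ := by
    rw [edgeSpan, Submodule.span_eq_bot]
    rintro x ⟨u, v, huv, -⟩
    exact absurd huv (h u v)
  rw [rank, this, finrank_bot]

theorem single_mem_span_of_verts [DecidableEq V] {A : G.Subgraph} {v : V} (hv : v ∈ A.verts) :
    (Pi.single v 1 : V → ℚ) ∈ Submodule.span ℚ (Set.range fun v : A.verts =>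
      (Pi.single (v : V) 1 : V → ℚ)) :=
  Submodule.subset_span ⟨⟨v, hv⟩, rfl⟩

theorem finrank_span_verts [DecidableEq V] [Fintype V] (A : G.Subgraph) :
    Module.finrank ℚ (Submodule.span ℚ (Set.range fun v : A.verts =>
      (Pi.single (v : V) 1 : V → ℚ))) = A.verts.ncard := by
  classical
  have hli : LinearIndependent ℚ (fun v : A.verts => (Pi.single (v : V) 1 : V → ℚ)) := by
    have := (Pi.basisFun ℚ V).linearIndependent.comp (fun v : A.verts => (v : V))
      Subtype.val_injective
    convert this using 1
    ext v
    simp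
  rw [finrank_span_eq_card hli, ← Nat.card_coe_set_eq, Nat.card_eq_fintype_card]

theorem rank_lt_ncard_verts [Fintype V] {A : G.Subgraph} (h : A.verts.Nonempty) :
    A.rank < A.verts.ncard := by
  classical
  obtain ⟨v, hv⟩ := h
  rw [← finrank_span_verts, rank]
  refine Submodule.finrank_lt_finrank_of_lt (lt_of_le_of_ne ?_ ?_)
  · rw [edgeSpan, Submodule.span_le]
    rintro _ ⟨u, w, huw, rfl⟩
    exact Submodule.sub_mem _ (single_mem_span_of_verts huw.fst_mem)
      (single_mem_span_of_verts huw.snd_mem)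
  · intro heq
    -- The coordinate sum kills every edge vector but not `e_v`, so the inclusion of spans is
    -- strict.
    have hker : A.edgeSpan ≤ LinearMap.ker (∑ u, LinearMap.proj u : (V → ℚ) →ₗ[ℚ] ℚ) := by
      rw [edgeSpan, Submodule.span_le]
      rintro _ ⟨u, w, huw, rfl⟩
      simp
    have := hker (heq ▸ single_mem_span_of_verts hv)
    simp at this

/-- Edge vectors telescope along a walk, so `e_v` for a single root `v` together with the edge span
generates all `e_w`. -/
theorem ncard_verts_le_rank_add_one [Fintype V] {A : G.Subgraph} (h : A.coe.Connected) :
    A.verts.ncard ≤ A.rank + 1 := by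
  classical
  obtain ⟨v⟩ := h.nonempty
  rw [← finrank_span_verts]
  have hle : Submodule.span ℚ (Set.range fun v : A.verts => (Pi.single (v : V) 1 : V → ℚ)) ≤
      A.edgeSpan ⊔ Submodule.span ℚ {(Pi.single (v : V) 1 : V → ℚ)} := by
    rw [Submodule.span_le]
    rintro _ ⟨w, rfl⟩
    have hw : (Pi.single (w : V) 1 - Pi.single (v : V) 1 : V → ℚ) ∈ A.edgeSpan := by
      obtain ⟨p⟩ := h.preconnected w v
      induction p with
      | nil => simp
      | cons hadj p ih =>
        rw [← sub_add_sub_cancel]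
        exact Submodule.add_mem _ (Submodule.subset_span ⟨_, _, hadj, rfl⟩) ih
    have := Submodule.add_mem_sup hw (Submodule.mem_span_singleton_self
      (R := ℚ) (Pi.single (v : V) 1 : V → ℚ))
    simpa using this
  refine (Submodule.finrank_mono hle).trans ((Submodule.finrank_add_le_finrank_add_finrank _ _).trans
    (Nat.add_le_add_left ?_ _))
  exact (finrank_span_le_card _).trans (by simp)

end SimpleGraph.Subgraph

/-! ### Coefficients of polynomials of exponential type -/

namespace SimpleGraph.Subgraph

open FinPoset Polynomial

variable {V : Type u} {G : SimpleGraph V}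

/-- The edgeless subgraph with vertex set `S`. -/
def edgeless (G : SimpleGraph V) (S : Set V) : G.Subgraph where
  verts := S
  Adj _ _ := False
  adj_sub := False.elim
  edge_vert := False.elim
  symm := ⟨fun _ _ => id⟩

theorem edgeless_le_iff {S : Set V} {A : G.Subgraph} : edgeless G S ≤ A ↔ S ⊆ A.verts :=
  ⟨fun h => h.1, fun h => ⟨h, fun _ _ => False.elim⟩⟩

theorem le_induce_iff {D A : G.Subgraph} {S : Set V} (hS : S ⊆ A.verts) :
    D ≤ A.induce S ↔ D.verts ⊆ S ∧ D ≤ A := by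
  constructor
  · exact fun h => ⟨h.1, h.1.trans hS, fun _ _ huv => (h.2 huv).2.2⟩
  · exact fun h => ⟨h.1, fun _ _ huv => ⟨h.1 huv.fst_mem, h.1 huv.snd_mem, h.2.2 huv⟩⟩

theorem le_deleteVerts_iff {D A : G.Subgraph} {S : Set V} :
    D ≤ A.deleteVerts S ↔ Disjoint D.verts S ∧ D ≤ A := by
  rw [deleteVerts, le_induce_iff Set.sdiff_subset, Set.subset_sdiff]
  exact ⟨fun h => ⟨h.1.2, h.2⟩, fun h => ⟨⟨h.2.1, h.1⟩, h.2⟩⟩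

theorem deleteVerts_mem_rankSpan (S : Set V) {k : ℕ} {φ : G.Subgraph → ℂ}
    (hφ : φ ∈ rankSpan rank k) :
    (fun A : G.Subgraph => φ (A.deleteVerts S)) ∈ rankSpan rank k := by
  have := mul_comp_mem_of_rankSpan (g := fun A : G.Subgraph => A.deleteVerts S) (w := fun _ => 1)
    (P := rankSpan rank k) (fun d hd => ?_) hφ
  · simpa using this
  · by_cases h : Disjoint d.verts S
    · convert upIndicator_mem_rankSpan hd using 1
      ext A
      have hA : d ≤ A.deleteVerts S ↔ d ≤ A := le_deleteVerts_iff.trans (and_iff_right h)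
      rw [one_mul]
      unfold upIndicator
      split_ifs <;> tauto
    · convert Submodule.zero_mem _ using 1
      ext A
      simp [upIndicator, le_deleteVerts_iff, h]

variable [Fintype V]

theorem rank_le_ncard_verts (A : G.Subgraph) : A.rank ≤ A.verts.ncard := by
  rcases A.verts.eq_empty_or_nonempty with h | h
  · rw [rank_eq_zero_of_forall_not_adj]
    · exact Nat.zero_le _
    · intro u v huv
      have := huv.fst_mem
      rw [h] at this
      exact this
  · exact (rank_lt_ncard_verts h).le

theorem mem_rankSpan_card (φ : G.Subgraph → ℂ) : φ ∈ rankSpan rank (Fintype.card V) := by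
  have := Fintype.ofFinite G.Subgraph
  refine mem_rankSpan_of_mobius_eq_zero fun d hd => absurd hd (not_lt.mpr ?_)
  refine (rank_le_ncard_verts d).trans ?_
  rw [← Nat.card_eq_fintype_card]
  exact Set.ncard_le_card _

-- The function `φ` is arbitrary: the bound comes from the prefactor. For `d` with vertices in `S`,
-- the condition is that `A` contains `d` with all of `S` adjoined as vertices, a subgraph on
-- exactly `S`, hence of rank at most `|S| - 1`.
open scoped Classical in
theorem induce_mem_rankSpan {S : Finset V} (hS : S.Nonempty) (φ : G.Subgraph → ℂ) :
    (fun A : G.Subgraph => (if (S : Set V) ⊆ A.verts then 1 else 0) * φ (A.induce S)) ∈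
      rankSpan rank (S.card - 1) := by
  refine mul_comp_mem_of_rankSpan (g := fun A => A.induce S) (fun d _ => ?_) (mem_rankSpan_card φ)
  by_cases hd : d.verts ⊆ S
  · have heq : (fun A : G.Subgraph => (if (S : Set V) ⊆ A.verts then 1 else 0) *
        upIndicator d (A.induce S)) = upIndicator (edgeless G S ⊔ d) := by
      ext A
      by_cases hA : (S : Set V) ⊆ A.verts
      · simp [upIndicator, edgeless_le_iff, le_induce_iff hA, hA, hd]
      · simp [upIndicator, edgeless_le_iff, hA]
    rw [heq]
    refine upIndicator_mem_rankSpan (Nat.le_sub_one_of_lt ?_)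
    have hverts : (edgeless G (S : Set V) ⊔ d).verts = S := by
      rw [verts_sup]
      exact Set.union_eq_left.mpr hd
    have := rank_lt_ncard_verts (A := edgeless G (S : Set V) ⊔ d) (by rw [hverts]; simpa using hS)
    rwa [hverts, Set.ncard_coe_finset] at this
  · convert Submodule.zero_mem _ using 1
    ext A
    by_cases hA : (S : Set V) ⊆ A.verts
    · simp [upIndicator, le_induce_iff hA, hd]
    · simp [hA]

-- Since `D ≤ A - v` means `D ≤ A` and `v ∉ D`, the sum over `v` counts the weight of `D` exactly
-- `|A| - |D|` times.
open scoped Classical in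
theorem lowerSum_ncard_mul_mobius [Fintype G.Subgraph] (φ : G.Subgraph → ℂ) (A : G.Subgraph) :
    lowerSum G.Subgraph (fun D => (D.verts.ncard : ℂ) * mobius φ D) A =
      A.verts.ncard * φ A - ∑ v with v ∈ A.verts, φ (A.deleteVerts {v}) := by
  have hφ : ∀ B, φ B = ∑ D, if D ≤ B then mobius φ D else 0 := by
    intro B
    conv_lhs => rw [← lowerSum_mobius φ]
    rw [lowerSum_apply, Finset.sum_filter]
  simp_rw [hφ]
  rw [Finset.sum_comm, Finset.mul_sum, ← Finset.sum_sub_distrib, lowerSum_apply,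
    Finset.sum_filter]
  refine Finset.sum_congr rfl fun D _ => ?_
  by_cases hD : D ≤ A
  · simp only [hD, le_deleteVerts_iff, if_true, and_true, Set.disjoint_singleton_right]
    rw [← Finset.sum_filter, Finset.sum_const, Finset.filter_filter, nsmul_eq_mul, ← sub_mul]
    congr 1
    have h1 : A.verts.ncard = (Finset.univ.filter fun v => v ∈ A.verts).card := by
      rw [← Set.ncard_coe_finset]; simp
    have h2 : D.verts.ncard = (Finset.univ.filter fun v => v ∈ A.verts ∧ v ∈ D.verts).card := by
      rw [← Set.ncard_coe_finset]
      congr 1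
      ext v
      simpa using fun hv => hD.1 hv
    rw [h1, h2, eq_sub_iff_add_eq, ← Nat.cast_add, ← Finset.filter_filter, ← Finset.filter_filter,
      Finset.card_filter_add_card_filter_not]
  · simp [hD, le_deleteVerts_iff]

/-- The coefficient of `x ^ (|A| - k)` in `F A`. -/
noncomputable def codegCoeff (F : G.Subgraph → ℂ[X]) (k : ℕ) (A : G.Subgraph) : ℂ :=
  if k ≤ A.verts.ncard then (F A).coeff (A.verts.ncard - k) else 0

open scoped Classical in
/-- A family of monic polynomials of exponential type on the subgraphs of a graph. -/
structure IsExponential (F : G.Subgraph → ℂ[X]) : Prop where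
  monic : ∀ A, (F A).Monic
  natDegree : ∀ A, (F A).natDegree = A.verts.ncard
  sum_eq : ∀ (A : G.Subgraph) (x y : ℂ), ∑ S ∈ Finset.univ.filter fun S : Finset V => (S : Set V) ⊆ A.verts,
    (F (A.induce S)).eval x * (F (A.deleteVerts S)).eval y = (F A).eval (x + y)

namespace IsExponential

variable {F : G.Subgraph → ℂ[X]}

-- Compare the coefficients of `x` in the exponential-type identity at fixed `y`.
open scoped Classical in
theorem derivative_eq (hF : IsExponential F) (A : G.Subgraph) :
    derivative (F A) = ∑ S ∈ Finset.univ.filter fun S : Finset V => (S : Set V) ⊆ A.verts,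
      C ((F (A.induce S)).coeff 1) * F (A.deleteVerts S) := by
  refine Polynomial.funext fun y => ?_
  have h : taylor y (F A) = ∑ S ∈ Finset.univ.filter fun S : Finset V => (S : Set V) ⊆ A.verts,
      C ((F (A.deleteVerts S)).eval y) * F (A.induce S) := by
    refine Polynomial.funext fun x => ?_
    rw [taylor_eval, ← hF.sum_eq, eval_finsetSum]
    exact Finset.sum_congr rfl fun S _ => by rw [eval_mul, eval_C, mul_comm]
  rw [← taylor_coeff_one, h, finsetSum_coeff, eval_finsetSum]
  exact Finset.sum_congr rfl fun S _ => by rw [coeff_C_mul, eval_mul, eval_C, mul_comm]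

theorem eq_one_of_verts_eq_empty (hF : IsExponential F) {A : G.Subgraph} (h : A.verts = ∅) :
    F A = 1 :=
  eq_one_of_monic_natDegree_zero (hF.monic A) (by rw [hF.natDegree, h, Set.ncard_empty])

theorem ncard_deleteVerts {A : G.Subgraph} {S : Finset V} (h : (S : Set V) ⊆ A.verts) :
    (A.deleteVerts S).verts.ncard + S.card = A.verts.ncard := by
  rw [deleteVerts_verts, ← Set.ncard_coe_finset]
  exact Set.ncard_sdiff_add_ncard_of_subset h

open scoped Classical in
theorem codegCoeff_recursion (hF : IsExponential F) (k : ℕ) (A : G.Subgraph) :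
    ((A.verts.ncard : ℂ) - k) * codegCoeff F k A =
      ∑ S : Finset V with S.Nonempty ∧ S.card ≤ k + 1, (if (S : Set V) ⊆ A.verts then 1 else 0) *
        (F (A.induce S)).coeff 1 * codegCoeff F (k + 1 - S.card) (A.deleteVerts S) := by
  rcases lt_or_ge k A.verts.ncard with hk | hk
  · have h := congrArg (fun p => p.coeff (A.verts.ncard - k - 1)) (hF.derivative_eq A)
    simp only [finsetSum_coeff, coeff_C_mul, coeff_derivative] at h
    rw [codegCoeff, if_pos hk.le, mul_comm]
    have hn : A.verts.ncard - k - 1 + 1 = A.verts.ncard - k := by omega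
    have hn' : ((A.verts.ncard - k - 1 : ℕ) : ℂ) + 1 = (A.verts.ncard : ℂ) - k := by
      rw [← Nat.cast_sub hk.le, ← Nat.cast_add_one, hn]
    rw [hn, hn'] at h
    rw [h, Finset.sum_filter, Finset.sum_filter]
    refine Finset.sum_congr rfl fun S _ => ?_
    by_cases hS : (S : Set V) ⊆ A.verts
    · have hcard := ncard_deleteVerts hS
      rw [if_pos hS]
      by_cases hS' : S.Nonempty ∧ S.card ≤ k + 1
      · rw [if_pos hS', if_pos hS, one_mul, codegCoeff, if_pos (by omega)]
        congr 2
        omega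
      · rw [if_neg hS']
        by_cases hne : S.Nonempty
        · have : k + 1 < S.card := by
            by_contra hlt
            exact hS' ⟨hne, not_lt.mp hlt⟩
          -- For `|S| > k + 1` the coefficient index `|A| - k - 1` exceeds the degree `|A| - |S|`.
          rw [coeff_eq_zero_of_natDegree_lt (p := F (A.deleteVerts S)), mul_zero]
          rw [hF.natDegree]
          omega
        · rw [Finset.not_nonempty_iff_eq_empty] at hne
          rw [hF.eq_one_of_verts_eq_empty (A := A.induce S) (by simp [hne]), coeff_one]
          simp
    · simp [hS]
  -- For `|A| ≤ k` both sides vanish: on the left through the factor when `|A| = k`, and otherwise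
  -- through the default value 0 of `codegCoeff`.
  · have h0 : ((A.verts.ncard : ℂ) - k) * codegCoeff F k A = 0 := by
      rcases hk.eq_or_lt with h | h
      · rw [h, sub_self, zero_mul]
      · rw [codegCoeff, if_neg (by omega), mul_zero]
    rw [h0, eq_comm]
    refine Finset.sum_eq_zero fun S hS => ?_
    by_cases hSA : (S : Set V) ⊆ A.verts
    · have hcard := ncard_deleteVerts hSA
      have := (Finset.mem_filter.mp hS).2
      rw [show codegCoeff F (k + 1 - S.card) (A.deleteVerts S) = 0 from if_neg (by omega), mul_zero]
    · simp [hSA]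

theorem coeff_one_of_ncard_eq_one (hF : IsExponential F) {A : G.Subgraph}
    (h : A.verts.ncard = 1) : (F A).coeff 1 = 1 := by
  have := hF.monic A
  rw [Monic, leadingCoeff, hF.natDegree, h] at this
  exact this

/-- The coefficient of codegree `k` is a combination of counts of subgraphs of rank at
most `k`. -/
theorem codegCoeff_mem_rankSpan (hF : IsExponential F) (k : ℕ) :
    codegCoeff F k ∈ rankSpan rank k := by
  classical
  have := Fintype.ofFinite G.Subgraph
  induction k using Nat.strong_induction_on with
  | _ k ih =>
  -- The terms with `|S| ≥ 2`. They involve only smaller codegrees, and their ranks add up to `(|S|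
  -- - 1) + (k + 1 - |S|) = k`.
  set ψ : G.Subgraph → ℂ := fun A =>
    ∑ S : Finset V with (S.Nonempty ∧ S.card ≤ k + 1) ∧ S.card ≠ 1,
      (if (S : Set V) ⊆ A.verts then 1 else 0) *
        (F (A.induce S)).coeff 1 * codegCoeff F (k + 1 - S.card) (A.deleteVerts S) with hψdef
  have hψ : ψ ∈ rankSpan rank k := by
    have : ψ = ∑ S : Finset V with (S.Nonempty ∧ S.card ≤ k + 1) ∧ S.card ≠ 1,
        (fun A : G.Subgraph => (if (S : Set V) ⊆ A.verts then 1 else 0) *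
          (F (A.induce S)).coeff 1) *
          fun A : G.Subgraph => codegCoeff F (k + 1 - S.card) (A.deleteVerts S) := by
      ext A
      simp [hψdef]
    rw [this]
    refine Submodule.sum_mem _ fun S hS => ?_
    obtain ⟨⟨hne, hle⟩, h1⟩ := (Finset.mem_filter.mp hS).2
    have hpos := hne.card_pos
    have hk : k = S.card - 1 + (k + 1 - S.card) := by omega
    have hmem := mul_mem_rankSpan rank_sup_le
      (induce_mem_rankSpan hne fun A : G.Subgraph => (F A).coeff 1)
      (deleteVerts_mem_rankSpan (S : Set V) (ih (k + 1 - S.card) (by omega)))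
    rw [← hk] at hmem
    exact hmem
  have hrec : ∀ A : G.Subgraph, ((A.verts.ncard : ℂ) - k) * codegCoeff F k A =
      ∑ v with v ∈ A.verts, codegCoeff F k (A.deleteVerts {v}) + ψ A := by
    intro A
    rw [hF.codegCoeff_recursion, ← Finset.sum_filter_add_sum_filter_not _ (fun S => S.card = 1),
      Finset.filter_filter, Finset.filter_filter]
    congr 1
    rw [Finset.sum_filter, Finset.sum_filter]
    symm
    refine Finset.sum_of_injOn (fun v => ({v} : Finset V)) ?_ (by simp) ?_ ?_
    · exact fun a _ b _ h => by simpa using h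
    · intro S _ hS
      refine if_neg fun h => hS ?_
      obtain ⟨v, rfl⟩ := Finset.card_eq_one.mp h.2
      exact ⟨v, by simp, rfl⟩
    · intro v _
      by_cases hv : v ∈ A.verts
      · have h1 : (F (A.induce {v})).coeff 1 = 1 := hF.coeff_one_of_ncard_eq_one (by simp)
        simp [hv, h1]
      · simp [hv]
  -- With the singleton terms on the left, the recursion becomes diagonal in the Möbius basis.
  have hmob : lowerSum G.Subgraph
      (fun D => ((D.verts.ncard : ℂ) - k) * mobius (codegCoeff F k) D) = ψ := by
    have hsplit : (fun D : G.Subgraph => ((D.verts.ncard : ℂ) - k) * mobius (codegCoeff F k) D) =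
        (fun D => (D.verts.ncard : ℂ) * mobius (codegCoeff F k) D) -
          (k : ℂ) • mobius (codegCoeff F k) := by
      ext D; simp [sub_mul]
    ext A
    rw [hsplit, map_sub, map_smul, lowerSum_mobius, Pi.sub_apply, lowerSum_ncard_mul_mobius,
      Pi.smul_apply, smul_eq_mul]
    linear_combination hrec A
  refine mem_rankSpan_of_mobius_eq_zero fun D hD => ?_
  have h0 := mobius_eq_zero_of_mem_rankSpan hψ hD
  rw [← eq_mobius hmob] at h0
  refine (mul_eq_zero.mp h0).resolve_left (sub_ne_zero.mpr ?_)
  exact_mod_cast (hD.trans_le (rank_le_ncard_verts D)).ne'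

end IsExponential

end SimpleGraph.Subgraph

/-! ### Power sums of roots -/

/-- Newton's identities for a multiset. -/
theorem Multiset.sum_map_pow_eq_esymm (s : Multiset ℂ) {k : ℕ} (hk : 0 < k) :
    (s.map (· ^ k)).sum = (-1) ^ (k + 1) * k * s.esymm k -
      ∑ a ∈ Finset.HasAntidiagonal.antidiagonal k with a.1 ∈ Set.Ioo 0 k,
        (-1) ^ a.1 * s.esymm a.1 * (s.map (· ^ a.2)).sum := by
  classical
  have he : ∀ j, MvPolynomial.aeval (fun x : s => (x.1 : ℂ)) (MvPolynomial.esymm s ℂ j) =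
      s.esymm j := by
    intro j
    rw [MvPolynomial.aeval_esymm_eq_multiset_esymm, Multiset.map_univ_coe]
  have hp : ∀ j, MvPolynomial.aeval (fun x : s => (x.1 : ℂ)) (MvPolynomial.psum s ℂ j) =
      (s.map (· ^ j)).sum := by
    intro j
    conv_rhs => rw [← Multiset.map_univ_coe s, Multiset.map_map]
    simp [MvPolynomial.psum]
  have h := congrArg (MvPolynomial.aeval fun x : s => (x.1 : ℂ))
    (MvPolynomial.psum_eq_mul_esymm_sub_sum s ℂ k hk)
  simpa only [map_sub, map_mul, map_sum, map_pow, map_neg, map_one, map_natCast, he, hp] using h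

namespace SimpleGraph.Subgraph

open FinPoset Polynomial

variable {V : Type u} [Fintype V] {G : SimpleGraph V}

/-- The `k`-th power sum of the roots of `F A`. -/
noncomputable def rootPowerSum (F : G.Subgraph → ℂ[X]) (k : ℕ) (A : G.Subgraph) : ℂ :=
  ((F A).roots.map (· ^ k)).sum

namespace IsExponential

variable {F : G.Subgraph → ℂ[X]}

/-- Vieta's formula; the default value of `codegCoeff` matches the vanishing of `esymm` beyond the
number of roots. -/
theorem esymm_roots (hF : IsExponential F) (k : ℕ) (A : G.Subgraph) :
    (F A).roots.esymm k = (-1) ^ k * codegCoeff F k A := by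
  have hcard : (F A).roots.card = (F A).natDegree :=
    (splits_iff_card_roots.mp (IsAlgClosed.splits (F A)))
  rw [codegCoeff]
  split_ifs with h
  · rw [coeff_eq_esymm_roots_of_card hcard (by rw [hF.natDegree]; omega), hF.natDegree,
      (hF.monic A).leadingCoeff, one_mul, Nat.sub_sub_self h, ← mul_assoc, ← mul_pow]
    simp
  · rw [Multiset.esymm, Multiset.powersetCard_eq_empty _ (by rw [hcard, hF.natDegree]; omega)]
    simp

/-- The `k`-th power sum of the roots is a combination of counts of subgraphs of rank at
most `k`. -/
theorem rootPowerSum_mem_rankSpan (hF : IsExponential F) {k : ℕ} (hk : 0 < k) :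
    rootPowerSum F k ∈ rankSpan rank k := by
  induction k using Nat.strong_induction_on with
  | _ k ih =>
  have heq : rootPowerSum F k = ((-1) ^ (k + 1) * k * (-1) ^ k : ℂ) • codegCoeff F k -
      ∑ a ∈ Finset.HasAntidiagonal.antidiagonal k with a.1 ∈ Set.Ioo 0 k,
        codegCoeff F a.1 * rootPowerSum F a.2 := by
    ext A
    rw [rootPowerSum, Multiset.sum_map_pow_eq_esymm _ hk, hF.esymm_roots]
    simp only [Pi.sub_apply, Pi.smul_apply, smul_eq_mul, Finset.sum_apply, Pi.mul_apply]
    congr 1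
    · ring
    · refine Finset.sum_congr rfl fun a _ => ?_
      rw [hF.esymm_roots, ← mul_assoc, ← mul_pow]
      simp [rootPowerSum]
  rw [heq]
  refine Submodule.sub_mem _ (Submodule.smul_mem _ _ (hF.codegCoeff_mem_rankSpan k))
    (Submodule.sum_mem _ fun a ha => ?_)
  obtain ⟨ha, hpos, hlt⟩ := Finset.mem_filter.mp ha
  rw [Finset.HasAntidiagonal.mem_antidiagonal] at ha
  rw [← ha]
  exact mul_mem_rankSpan rank_sup_le (hF.codegCoeff_mem_rankSpan _) (ih a.2 (by omega) (by omega))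

end IsExponential

/-- A family of monic polynomials of exponential type that is multiplicative for disjoint unions
and for gluings at a vertex. -/
structure IsTwoMultiplicative (F : G.Subgraph → ℂ[X]) : Prop extends IsExponential F where
  map_sup : ∀ A B : G.Subgraph, Disjoint A.verts B.verts → F (A ⊔ B) = F A * F B
  X_mul_map_sup : ∀ (A B : G.Subgraph) (v : V), A.verts ∩ B.verts = {v} →
    X * F (A ⊔ B) = F A * F B

/-! ### Support of the Möbius inverse of the power sums -/

namespace IsTwoMultiplicative

variable {F : G.Subgraph → ℂ[X]}

theorem rootPowerSum_eq_zero (hF : IsTwoMultiplicative F) {k : ℕ} (hk : 0 < k) {A : G.Subgraph}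
    (hA : A.verts.Subsingleton) : rootPowerSum F k A = 0 := by
  rcases hA.eq_empty_or_singleton with h | ⟨v, h⟩
  · rw [rootPowerSum, hF.eq_one_of_verts_eq_empty h]
    simp
  -- Gluing a one-vertex subgraph to itself gives `X * F A = F A * F A`, so `F A = X`.
  · have := hF.X_mul_map_sup A A v (by rw [Set.inter_self, h])
    rw [sup_idem] at this
    rw [rootPowerSum, ← mul_right_cancel₀ (hF.monic A).ne_zero this, roots_X]
    simp [hk.ne']

theorem rootPowerSum_sup (hF : IsTwoMultiplicative F) {k : ℕ} (hk : 0 < k) {A B : G.Subgraph}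
    (h : (A.verts ∩ B.verts).Subsingleton) :
    rootPowerSum F k (A ⊔ B) = rootPowerSum F k A + rootPowerSum F k B := by
  have hne : F A * F B ≠ 0 := mul_ne_zero (hF.monic A).ne_zero (hF.monic B).ne_zero
  rcases h.eq_empty_or_singleton with h | ⟨v, h⟩
  · simp only [rootPowerSum]
    rw [hF.map_sup A B (Set.disjoint_iff_inter_eq_empty.mpr h), roots_mul hne]
    simp
  · have hX := hF.X_mul_map_sup A B v h
    have hr := congrArg (fun p => (p.roots.map (· ^ k)).sum) hX
    simp only [roots_mul hne, roots_mul (hX ▸ hne)] at hr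
    simpa [hk.ne', rootPowerSum] using hr

variable [Fintype G.Subgraph]

/-- The Möbius inverse of the power sums vanishes at a subgraph that is disconnected or has a cut
vertex: `U` is a union of components after the removal of `X`. -/
theorem mobius_rootPowerSum_eq_zero (hF : IsTwoMultiplicative F) {k : ℕ} (hk : 0 < k)
    {A : G.Subgraph} {X U : Set V} (hX : X.Subsingleton) (hXA : X ⊆ A.verts) (hUA : U ⊆ A.verts)
    (hU : U.Nonempty) {b : V} (hb : b ∈ A.verts) (hbU : b ∉ U) (hbX : b ∉ X)
    (hsep : ∀ u ∈ U, ∀ v ∉ U, v ∉ X → ¬ A.Adj u v) : mobius (rootPowerSum F k) A = 0 := by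
  refine mobius_eq_zero_of_additive (P := fun A B => (A.verts ∩ B.verts).Subsingleton)
    (a₁ := A.induce (U ∪ X)) (a₂ := A.induce (A.verts \ U)) ?_
    (fun _ _ h => hF.rootPowerSum_sup hk h) (fun _ _ h => hF.rootPowerSum_eq_zero hk h) ?_ ?_ ?_ ?_
  · exact fun _ _ _ h => h.anti (Set.inter_subset_inter Set.inter_subset_right
      Set.inter_subset_right)
  · refine hX.anti ?_
    rintro x ⟨hx | hx, hx'⟩
    · exact absurd hx hx'.2
    · exact hx
  · refine le_antisymm (sup_le ?_ ?_) ⟨fun x hx => ?_, fun u v huv => ?_⟩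
    · exact ((le_induce_iff (Set.union_subset hUA hXA)).mp le_rfl).2
    · exact ((le_induce_iff Set.sdiff_subset).mp le_rfl).2
    · by_cases hxU : x ∈ U
      · exact Or.inl (Or.inl hxU)
      · exact Or.inr ⟨hx, hxU⟩
    · by_cases hu : u ∈ U <;> by_cases hv : v ∈ U
      · exact Or.inl ⟨Or.inl hu, Or.inl hv, huv⟩
      · by_cases hvX : v ∈ X
        · exact Or.inl ⟨Or.inl hu, Or.inr hvX, huv⟩
        · exact absurd huv (hsep u hu v hv hvX)
      · by_cases huX : u ∈ X
        · exact Or.inl ⟨Or.inr huX, Or.inl hv, huv⟩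
        · exact absurd huv.symm (hsep v hv u hu huX)
      · exact Or.inr ⟨⟨huv.fst_mem, hu⟩, ⟨huv.snd_mem, hv⟩, huv⟩
  · intro h
    have : b ∈ (A.induce (U ∪ X)).verts := by rw [h]; exact hb
    exact this.elim hbU hbX
  · intro h
    obtain ⟨x, hx⟩ := hU
    have : x ∈ (A.induce (A.verts \ U)).verts := by rw [h]; exact hUA hx
    exact this.2 hx

theorem exists_separation {W : Type*} {H : SimpleGraph W} (h : ¬ H.Preconnected) :
    ∃ (U : Set W) (a b : W), a ∈ U ∧ b ∉ U ∧ ∀ u ∈ U, ∀ v ∉ U, ¬ H.Adj u v := by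
  simp only [SimpleGraph.Preconnected, not_forall] at h
  obtain ⟨a, b, hab⟩ := h
  exact ⟨{u | H.Reachable a u}, a, b, SimpleGraph.Reachable.refl a, hab,
    fun u hu v hv huv => hv (hu.trans huv.reachable)⟩

/-- The Möbius inverse of the `k`-th power sum is supported on `2`-connected subgraphs with at most
`k + 1` vertices. -/
theorem twoConnected_of_mobius_ne_zero (hF : IsTwoMultiplicative F) {k : ℕ} (hk : 0 < k)
    {A : G.Subgraph} (hA : mobius (rootPowerSum F k) A ≠ 0) :
    2 ≤ A.verts.ncard ∧ A.verts.ncard ≤ k + 1 ∧ A.coe.Connected ∧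
      ∀ v : A.verts, (A.coe.induce {v}ᶜ).Connected := by
  have h2 : 1 < A.verts.ncard := by
    rw [Set.one_lt_ncard_iff_nontrivial, ← Set.not_subsingleton_iff]
    exact fun h => hA (mobius_eq_zero_of_forall_le fun B hB =>
      hF.rootPowerSum_eq_zero hk (h.anti hB.1))
  have hnt := Set.one_lt_ncard_iff_nontrivial.mp h2
  have hconn : A.coe.Connected := by
    obtain ⟨w, hw⟩ := hnt.nonempty
    refine (SimpleGraph.connected_iff _).mpr ⟨?_, ⟨⟨w, hw⟩⟩⟩
    by_contra hpre
    obtain ⟨U, a, b, ha, hb, hsep⟩ := exists_separation hpre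
    refine hA (hF.mobius_rootPowerSum_eq_zero hk (X := ∅) (U := Subtype.val '' U) (b := b)
      Set.subsingleton_empty (Set.empty_subset _) ?_
      ⟨a, a, ha, rfl⟩ b.2 ?_ (Set.notMem_empty _) ?_)
    · rintro _ ⟨x, -, rfl⟩
      exact x.2
    · rintro ⟨x, hx, hxb⟩
      exact hb (Subtype.ext hxb ▸ hx)
    · rintro _ ⟨x, hx, rfl⟩ v hv - hadj
      exact hsep x hx ⟨v, hadj.snd_mem⟩ (fun h => hv ⟨_, h, rfl⟩) hadj
  refine ⟨h2, ?_, hconn, fun v => ?_⟩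
  · by_contra hlt
    -- More than `k + 1` vertices would force rank greater than `k`.
    have hrank := ncard_verts_le_rank_add_one hconn
    exact hA (mobius_eq_zero_of_mem_rankSpan (hF.rootPowerSum_mem_rankSpan hk) (by omega))
  · obtain ⟨w, hw, hwv⟩ := hnt.exists_ne (v : V)
    refine (SimpleGraph.connected_iff _).mpr ⟨?_, ⟨⟨⟨w, hw⟩, fun h => hwv (congrArg Subtype.val h)⟩⟩⟩
    by_contra hpre
    obtain ⟨U, a, b, ha, hb, hsep⟩ := exists_separation hpre
    refine hA (hF.mobius_rootPowerSum_eq_zero hk (X := {(v : V)})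
      (U := (fun x : ({v}ᶜ : Set A.verts) => ((x : A.verts) : V)) '' U) (b := (b : A.verts))
      Set.subsingleton_singleton (Set.singleton_subset_iff.mpr v.2) ?_
      ⟨_, a, ha, rfl⟩ (b : A.verts).2 ?_ ?_ ?_)
    · rintro _ ⟨x, -, rfl⟩
      exact (x : A.verts).2
    · rintro ⟨x, hx, hxb⟩
      exact hb (Subtype.ext (Subtype.ext hxb) ▸ hx)
    · exact fun h => b.2 (Subtype.ext h)
    · rintro _ ⟨x, hx, rfl⟩ y hy hyv hadj
      exact hsep x hx ⟨⟨y, hadj.snd_mem⟩, fun h => hyv (congrArg Subtype.val h)⟩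
        (fun h => hy ⟨_, h, rfl⟩) hadj

end IsTwoMultiplicative

end SimpleGraph.Subgraph

/-! ### Invariance under isomorphism -/

namespace SimpleGraph.Subgraph

variable {V W : Type*} {G : SimpleGraph V} {H : SimpleGraph W}

/-- A subgraph is isomorphic to its image under an injective homomorphism. -/
noncomputable def isoMapOfInjective (j : H →g G) (hj : Function.Injective j) (B : H.Subgraph) :
    B.coe ≃g (B.map j).coe where
  toEquiv := Equiv.Set.image j B.verts hj
  map_rel_iff' := by
    rintro ⟨x, hx⟩ ⟨y, hy⟩
    change Relation.Map B.Adj j j (j x) (j y) ↔ B.Adj x y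
    exact ⟨fun ⟨x', y', h, hx', hy'⟩ => hj hx' ▸ hj hy' ▸ h, fun h => ⟨x, y, h, rfl, rfl⟩⟩

theorem map_le_map_iff_of_injective {j : H →g G} (hj : Function.Injective j) {B C : H.Subgraph} :
    B.map j ≤ C.map j ↔ B ≤ C := by
  refine ⟨fun h => ⟨fun x hx => ?_, fun x y hxy => ?_⟩, fun h => map_mono h⟩
  · obtain ⟨y, hy, hyx⟩ := h.1 ⟨x, hx, rfl⟩
    exact hj hyx ▸ hy
  · obtain ⟨x', y', h', hx', hy'⟩ := h.2 ⟨x, y, hxy, rfl, rfl⟩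
    exact hj hx' ▸ hj hy' ▸ h'

theorem exists_map_eq_of_le_map {j : H →g G} {B : H.Subgraph} {A : G.Subgraph}
    (h : A ≤ B.map j) : ∃ C : H.Subgraph, C.map j = A := by
  refine ⟨A.comap j, le_antisymm ((map_le_iff_le_comap _ _ _).mpr le_rfl) ⟨?_, ?_⟩⟩
  · intro x hx
    obtain ⟨y, -, rfl⟩ := h.1 hx
    exact ⟨y, hx, rfl⟩
  · intro x y hxy
    obtain ⟨x', y', h', rfl, rfl⟩ := h.2 hxy
    exact ⟨x', y', ⟨B.adj_sub h', hxy⟩, rfl, rfl⟩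

end SimpleGraph.Subgraph

/-! ### Weights and subgraph counts -/

namespace FinGraph

open FinPoset SimpleGraph

noncomputable instance fintypeSubgraph (G : FinGraph.{u}) : Fintype G.graph.Subgraph :=
  Fintype.ofFinite _

/-- A function is invariant under isomorphism. -/
def IsInvariant {β : Type*} (φ : FinGraph.{u} → β) : Prop :=
  ∀ G₁ G₂ : FinGraph.{u}, Nonempty (G₁.graph ≃g G₂.graph) → φ G₁ = φ G₂

/-- The Möbius inverse of a function of graphs with respect to the subgraph order. -/
noncomputable def weight (φ : FinGraph.{u} → ℂ) (G : FinGraph.{u}) : ℂ :=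
  mobius (fun A : G.graph.Subgraph => φ (G.ofSubgraph A)) ⊤

/-- Taking images identifies the subgraphs of `C` with those of `C.map j`, so both sides have the
same lower sums. It makes weights independent of the ambient graph. -/
theorem mobius_map {φ : FinGraph.{u} → ℂ} (hφ : IsInvariant φ) {G H : FinGraph.{u}}
    (j : H.graph →g G.graph) (hj : Function.Injective j) (B : H.graph.Subgraph) :
    mobius (fun A : G.graph.Subgraph => φ (G.ofSubgraph A)) (B.map j) =
      mobius (fun A : H.graph.Subgraph => φ (H.ofSubgraph A)) B := by
  classical
  refine congrFun (eq_mobius (m := fun B : H.graph.Subgraph =>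
    mobius (fun A : G.graph.Subgraph => φ (G.ofSubgraph A)) (B.map j)) ?_) B
  ext C
  have hC : φ (H.ofSubgraph C) = φ (G.ofSubgraph (C.map j)) :=
    hφ _ _ ⟨Subgraph.isoMapOfInjective j hj C⟩
  rw [hC]
  refine Eq.trans ?_ (congrFun (lowerSum_mobius fun A : G.graph.Subgraph => φ (G.ofSubgraph A))
    (C.map j))
  rw [lowerSum_apply, lowerSum_apply]
  refine Finset.sum_bij (fun D _ => D.map j) ?_ ?_ ?_ ?_
  · intro D hD
    simpa [Subgraph.map_le_map_iff_of_injective hj] using hD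
  · intro D _ E _ h
    exact le_antisymm ((Subgraph.map_le_map_iff_of_injective hj).mp h.le)
      ((Subgraph.map_le_map_iff_of_injective hj).mp h.ge)
  · intro A hA
    have hA' : A ≤ C.map j := by simpa using hA
    obtain ⟨D, rfl⟩ := Subgraph.exists_map_eq_of_le_map hA'
    exact ⟨D, by simpa [Subgraph.map_le_map_iff_of_injective hj] using hA', rfl⟩
  · exact fun _ _ => rfl

theorem weight_ofSubgraph {φ : FinGraph.{u} → ℂ} (hφ : IsInvariant φ) (G : FinGraph.{u})
    (A : G.graph.Subgraph) :
    weight φ (G.ofSubgraph A) = mobius (fun A : G.graph.Subgraph => φ (G.ofSubgraph A)) A := by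
  have h := mobius_map hφ (G := G) (H := G.ofSubgraph A) A.hom Subgraph.hom_injective ⊤
  rw [weight, ← h]
  exact congrArg _ (Subgraph.map_hom_top A)

theorem isInvariant_weight {φ : FinGraph.{u} → ℂ} (hφ : IsInvariant φ) :
    IsInvariant (weight φ) := by
  rintro G₁ G₂ ⟨e⟩
  rw [weight, ← mobius_map hφ (G := G₂) (H := G₁) e.toHom e.injective ⊤, Subgraph.map_iso_top, weight]

theorem eq_sum_weight {φ : FinGraph.{u} → ℂ} (hφ : IsInvariant φ) (G : FinGraph.{u}) :
    φ G = ∑ A : G.graph.Subgraph, weight φ (G.ofSubgraph A) := by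
  classical
  simp only [weight_ofSubgraph hφ]
  have h : φ G = φ (G.ofSubgraph ⊤) := hφ _ _ ⟨Subgraph.topIso.symm⟩
  have h' := congrFun (lowerSum_mobius fun A : G.graph.Subgraph => φ (G.ofSubgraph A)) ⊤
  rw [lowerSum_apply] at h'
  rw [h, ← h']
  simp

open scoped Classical in
theorem subgraphCount_eq_sum (H G : FinGraph.{u}) :
    H.subgraphCount G = ∑ A : G.graph.Subgraph,
      if Nonempty (H.graph ≃g (G.ofSubgraph A).graph) then (1 : ℂ) else 0 := by
  rw [subgraphCount, SimpleGraph.copyCount, Finset.sum_boole]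
  exact congrArg _ (Finset.card_bij (fun A _ => A)
    (fun A hA => Finset.mem_filter.mpr ⟨Finset.mem_univ _, (Finset.mem_filter.mp hA).2⟩)
    (fun _ _ _ _ h => h)
    (fun A hA => ⟨A, Finset.mem_filter.mpr
      ⟨@Finset.mem_univ _ (_) _, (Finset.mem_filter.mp hA).2⟩, rfl⟩))

/-- Graphs on the vertex sets `{0, …, n - 1}` with `n ≤ N`. -/
abbrev Standard (N : ℕ) := Σ n : Fin (N + 1), SimpleGraph (ULift.{u} (Fin n))

/-- A standard graph as a bundled graph. -/
def ofStandard {N : ℕ} (r : Standard.{u} N) : FinGraph.{u} := ⟨ULift.{u} (Fin r.1), r.2⟩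

theorem exists_ofStandard_iso {N : ℕ} {G : FinGraph.{u}} (hG : Fintype.card G.V ≤ N) :
    ∃ r : Standard.{u} N, Nonempty ((ofStandard r).graph ≃g G.graph) := by
  let e : ULift.{u} (Fin (Fintype.card G.V)) ≃ G.V :=
    Equiv.ulift.trans (Fintype.equivFin G.V).symm
  exact ⟨⟨⟨Fintype.card G.V, Nat.lt_succ_of_le hG⟩, G.graph.comap e⟩, ⟨SimpleGraph.Iso.comap e _⟩⟩

/-- An invariant function whose Möbius inverse is supported on a class of graphs of bounded order
is a combination of the subgraph counts of the class. -/
theorem mem_countSpan {φ : FinGraph.{u} → ℂ} (hφ : IsInvariant φ) {𝓗 : Set FinGraph.{u}} {N : ℕ}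
    (h𝓗 : ∀ H, weight φ H ≠ 0 → H ∈ 𝓗 ∧ Fintype.card H.V ≤ N) : φ ∈ countSpan 𝓗 := by
  classical
  have : Fintype (Standard.{u} N) := Fintype.ofFinite _
  -- An isomorphism type may have many standard representatives; dividing by their number makes the
  -- type count once.
  let c : FinGraph.{u} → ℕ := fun H =>
    (Finset.univ.filter fun r : Standard.{u} N => Nonempty ((ofStandard r).graph ≃g H.graph)).card
  have hc : ∀ G₁ G₂ : FinGraph.{u}, Nonempty (G₁.graph ≃g G₂.graph) → c G₁ = c G₂ := by
    rintro G₁ G₂ ⟨e⟩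
    simp only [c]
    congr 1
    ext r
    simp only [Finset.mem_filter, Finset.mem_univ, true_and]
    exact ⟨fun ⟨e'⟩ => ⟨e'.trans e⟩, fun ⟨e'⟩ => ⟨e'.trans e.symm⟩⟩
  have hsum : φ = ∑ r : Standard.{u} N,
      (weight φ (ofStandard r) / c (ofStandard r)) • subgraphCount (ofStandard r) := by
    ext G
    rw [eq_sum_weight hφ G, Finset.sum_apply]
    simp only [Pi.smul_apply, subgraphCount_eq_sum, smul_eq_mul, Finset.mul_sum]
    rw [Finset.sum_comm]
    refine Finset.sum_congr rfl fun A _ => ?_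
    have hterm : ∀ r : Standard.{u} N, weight φ (ofStandard r) / c (ofStandard r) *
        (if Nonempty ((ofStandard r).graph ≃g (G.ofSubgraph A).graph) then (1 : ℂ) else 0) =
        if Nonempty ((ofStandard r).graph ≃g (G.ofSubgraph A).graph) then
          weight φ (G.ofSubgraph A) / c (G.ofSubgraph A) else 0 := by
      intro r
      split_ifs with h
      · rw [isInvariant_weight hφ _ _ h, hc _ _ h, mul_one]
      · rw [mul_zero]
    simp only [hterm]
    rw [← Finset.sum_filter, Finset.sum_const, nsmul_eq_mul]
    by_cases h0 : weight φ (G.ofSubgraph A) = 0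
    · simp [h0]
    · refine (mul_div_cancel₀ _ ?_).symm
      obtain ⟨r, hr⟩ := exists_ofStandard_iso (h𝓗 _ h0).2
      exact Nat.cast_ne_zero.mpr (Finset.card_ne_zero_of_mem (a := r) (by simpa using hr))
  rw [hsum]
  refine Submodule.sum_mem _ fun r _ => ?_
  by_cases h0 : weight φ (ofStandard r) = 0
  · rw [h0, zero_div, zero_smul]
    exact Submodule.zero_mem _
  · exact Submodule.smul_mem _ _ (Submodule.subset_span ⟨_, (h𝓗 _ h0).1, rfl⟩)

theorem card_ofSubgraph (G : FinGraph.{u}) (A : G.graph.Subgraph) :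
    Fintype.card (G.ofSubgraph A).V = A.verts.ncard := by
  rw [← Nat.card_eq_fintype_card]
  exact Nat.card_coe_set_eq _

/-- An induced subgraph of a subgraph, as a subgraph of the ambient graph. -/
noncomputable def induceOfSubgraphIso (G : FinGraph.{u}) (A : G.graph.Subgraph) (S : Set A.verts) :
    ((G.ofSubgraph A).induce S).graph ≃g
      (G.ofSubgraph (A.induce (Subtype.val '' S))).graph where
  toEquiv := Equiv.Set.image Subtype.val S Subtype.val_injective
  map_rel_iff' := by
    rintro ⟨x, hx⟩ ⟨y, hy⟩
    exact ⟨fun h => h.2.2, fun h => ⟨⟨x, hx, rfl⟩, ⟨y, hy, rfl⟩, h⟩⟩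

theorem restrict_sup_restrict {V : Type*} {G : SimpleGraph V} (A B : G.Subgraph) :
    (Subgraph.restrict A ⊔ Subgraph.restrict B : (A ⊔ B).coe.Subgraph) = ⊤ := by
  refine top_le_iff.mp ⟨fun x _ => x.2, fun x y h => ?_⟩
  have h' : A.Adj x y ∨ B.Adj x y := h
  exact h'.imp (fun hA => ⟨h, hA⟩) fun hB => ⟨h, hB⟩

/-- A subgraph of a subgraph, as a subgraph of the ambient graph. -/
theorem nonempty_restrict_iso (G : FinGraph.{u}) {A C : G.graph.Subgraph} (h : A ≤ C) :
    Nonempty (((G.ofSubgraph C).ofSubgraph (Subgraph.restrict A : C.coe.Subgraph)).graph ≃g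
      (G.ofSubgraph A).graph) := by
  have e := Subgraph.isoMapOfInjective C.hom Subgraph.hom_injective (Subgraph.restrict A)
  have heq : (Subgraph.restrict A : C.coe.Subgraph).map C.hom = A :=
    (Subgraph.coeSubgraph_restrict_eq A).trans (inf_eq_right.mpr h)
  rw [heq] at e
  exact ⟨e⟩

end FinGraph

/-! ### From a graph polynomial to a family on the subgraphs of one graph -/

namespace GraphPolynomial

open SimpleGraph Polynomial FinPoset

variable {f : GraphPolynomial.{u}}

theorem isExponential_ofSubgraph (hiso : f.IsomInvariant) (hmonic : f.IsMonic)
    (hexp : f.IsExponentialType) (G : FinGraph.{u}) :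
    Subgraph.IsExponential fun A : G.graph.Subgraph => f (G.ofSubgraph A) where
  monic A := (hmonic _).1
  natDegree A := by rw [(hmonic _).2, G.card_ofSubgraph]
  sum_eq A x y := by
    classical
    refine Eq.trans (Eq.symm ?_) (hexp.2 (G.ofSubgraph A) x y)
    refine Finset.sum_bij
      (fun (S : Finset A.verts) _ => S.map (Function.Embedding.subtype (· ∈ A.verts))) ?_ ?_ ?_ ?_
    · intro S _
      simp only [Finset.mem_filter, Finset.mem_univ, true_and]
      intro v hv
      obtain ⟨w, -, rfl⟩ := Finset.mem_map.mp (Finset.mem_coe.mp hv)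
      exact w.2
    · exact fun S _ T _ h => Finset.map_injective _ h
    · intro T hT
      have hT' : (T : Set G.V) ⊆ A.verts := by simpa using hT
      refine ⟨T.subtype (· ∈ A.verts), Finset.mem_univ _, ?_⟩
      exact Finset.subtype_map_of_mem fun v hv => hT' hv
    · intro (S : Finset A.verts) _
      have h₁ := hiso _ _ ⟨G.induceOfSubgraphIso A (S : Set A.verts)⟩
      have h₂ := hiso _ _ ⟨G.induceOfSubgraphIso A (S : Set A.verts)ᶜ⟩
      have hS : ((S.map (Function.Embedding.subtype (· ∈ A.verts)) : Finset G.V) : Set G.V) =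
          Subtype.val '' (S : Set A.verts) := Finset.coe_map _ _
      have hS' : Subtype.val '' (S : Set A.verts)ᶜ = A.verts \ Subtype.val '' (S : Set A.verts) := by
        rw [Set.image_compl_eq_range_sdiff_image Subtype.val_injective, Subtype.range_coe]
      rw [hS'] at h₂
      simp only [hS, Subgraph.deleteVerts]
      rw [← h₁, ← h₂]
      rfl

theorem isTwoMultiplicative_ofSubgraph (hiso : f.IsomInvariant) (hmonic : f.IsMonic)
    (hexp : f.IsExponentialType) (h2 : f.IsTwoMultiplicative) (G : FinGraph.{u}) :
    Subgraph.IsTwoMultiplicative fun A : G.graph.Subgraph => f (G.ofSubgraph A) where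
  toIsExponential := isExponential_ofSubgraph hiso hmonic hexp G
  map_sup A B h := by
    rw [h2.1 (G.ofSubgraph (A ⊔ B)) (Subgraph.restrict A) (Subgraph.restrict B)
        (FinGraph.restrict_sup_restrict A B)
        (h.preimage _),
      hiso _ _ (G.nonempty_restrict_iso le_sup_left),
      hiso _ _ (G.nonempty_restrict_iso le_sup_right)]
  X_mul_map_sup A B v h := by
    have hv : v ∈ A.verts ∩ B.verts := h ▸ Set.mem_singleton v
    rw [h2.2 (G.ofSubgraph (A ⊔ B)) (Subgraph.restrict A) (Subgraph.restrict B)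
        (FinGraph.restrict_sup_restrict A B)
        ⟨⟨v, Or.inl hv.1⟩, ?_⟩,
      hiso _ _ (G.nonempty_restrict_iso le_sup_left),
      hiso _ _ (G.nonempty_restrict_iso le_sup_right)]
    ext x
    exact (Set.ext_iff.mp h (x : (A ⊔ B).verts).1).trans
      ⟨fun hx => Subtype.ext hx, fun hx => congrArg Subtype.val hx⟩

end GraphPolynomial

theorem theorem6p5 (f : GraphPolynomial.{u}) (hiso : f.IsomInvariant) (hmonic : f.IsMonic)
    (hexp : f.IsExponentialType) (h2 : f.IsTwoMultiplicative) (k : ℕ) (hk : 1 ≤ k) :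
    f.powerSum k ∈ FinGraph.countSpan
      {H : FinGraph.{u} |
        H.IsTwoConnected ∧ 2 ≤ Fintype.card H.V ∧ Fintype.card H.V ≤ k + 1} := by
  have hinv : FinGraph.IsInvariant (f.powerSum k) := fun G₁ G₂ h => by
    simp only [GraphPolynomial.powerSum, hiso G₁ G₂ h]
  refine FinGraph.mem_countSpan hinv (N := k + 1) fun H hH => ?_
  have hF := GraphPolynomial.isTwoMultiplicative_ofSubgraph hiso hmonic hexp h2 H
  -- The weight of `H` is by definition the Möbius inverse at the top of its own subgraph poset, so
  -- the support result applies with `A = ⊤`.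
  obtain ⟨hle, hle', hconn, hconn'⟩ := hF.twoConnected_of_mobius_ne_zero hk hH
  have hcard : (⊤ : H.graph.Subgraph).verts.ncard = Fintype.card H.V := by
    rw [SimpleGraph.Subgraph.verts_top, Set.ncard_univ, Nat.card_eq_fintype_card]
  rw [hcard] at hle hle'
  let e : (⊤ : H.graph.Subgraph).coe ≃g H.graph := SimpleGraph.Subgraph.topIso
  refine ⟨⟨⟨hle, (SimpleGraph.Iso.connected_iff e).mp hconn, fun v => ?_⟩, hle, hle'⟩, hle'⟩
  have e' : (⊤ : H.graph.Subgraph).coe.induce {e.symm v}ᶜ ≃g H.graph.induce {v}ᶜ :=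
    { toEquiv := e.toEquiv.subtypeEquiv fun a => by
        simp only [Set.mem_compl_iff, Set.mem_singleton_iff, not_iff_not]
        exact e.toEquiv.eq_symm_apply
      map_rel_iff' := e.map_rel_iff' }
  exact (SimpleGraph.Iso.connected_iff e').mp (hconn' _)
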